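/- Let $n\ge 0$ be an integer and let $S$ be a uniformly random subset of $\{0,1\}^n$ (each of the $2^{2^n}$ subsets having the same probability). An $r$-dimensional subcube of $\{0,1\}^n$ is a set of the form $\{x\in\{0,1\}^n : x_i=\alpha_i \text{ for all } i\notin J\}$, where $J\subseteq\{1,\dots,n\}$ has exactly $r$ elements and $\alpha_i\in\{0,1\}$ for $i\notin J$. Let $X_r=X_r(S)$ be the number of $r$-dimensional subcubes $C$ of $\{0,1\}^n$ with $C\subseteq S$, and let $\mu_r(n)=\mathbb{E}[X_r]$. Then $$\mathbb{E}\big[(X_2-\mu_2(n))^3\big]=\frac{2^{n}\,n(n-1)}{32768}\left(9n^{4}+6n^{3}+21n^{2}-16n-34\right),$$ $$\begin{aligned}\mathbb{E}\big[(X_2-\mu_2(n))^4\big]=\frac{2^{n}\,n(n-1)}{4194304}\big(&12n^{6}2^{n}+12n^{5}2^{n}+520n^{6}+24n^{4}2^{n}-24n^{5}-12n^{3}2^{n}+1272n^{4}\\&-9n^{2}2^{n}-840n^{3}-27n\,2^{n}-5232n^{2}-2768n+240\big),\end{aligned}$$ $$\mathbb{E}\big[(X_3-\mu_3(n))^3\big]=\frac{2^{n}\,n(n-1)(n-2)}{2415919104}\left(14n^{6}+24n^{5}+479n^{4}+2046n^{3}+6779n^{2}+15444n-23112\right).$$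 -/

import Mathlib

/-- The vertex set `{0,1}^n` of the discrete unit cube. -/
abbrev Cube (n : ℕ) : Type := Fin n → Bool

/-- The subcube through `a` whose set of free coordinates is `J`: all the points that agree
with `a` in every coordinate outside `J`. -/
def subcube {n : ℕ} (J : Finset (Fin n)) (a : Cube n) : Finset (Cube n) :=
  Finset.univ.filter fun x => ∀ i, i ∉ J → x i = a i

/-- The finite set of all `r`-dimensional subcubes of `{0,1}^n`, as sets of vertices
(empty if `r > n`). -/
def subcubes (n r : ℕ) : Finset (Finset (Cube n)) :=
  Finset.univ.filter fun C => ∃ (J : Finset (Fin n)) (a : Cube n), J.card = r ∧ C = subcube J a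

/-- `X_r(S)`: the number of `r`-dimensional subcubes of `{0,1}^n` contained in `S`. -/
def subcubeCount (n r : ℕ) (S : Finset (Cube n)) : ℕ :=
  ((subcubes n r).filter fun C => C ⊆ S).card

/-- The law of a uniformly random subset of `{0,1}^n`. -/
noncomputable def uniformSubset (n : ℕ) : MeasureTheory.Measure (Finset (Cube n)) :=
  ProbabilityTheory.uniformOn Set.univ

/-- The `k`-th moment about the mean of `X_r`, `E[(X_r - E[X_r])^k]`, for a uniformly random
subset of `{0,1}^n`. -/
noncomputable def subcubeCentralMoment (n r k : ℕ) : ℝ :=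
  ProbabilityTheory.centralMoment (fun S => (subcubeCount n r S : ℝ)) k (uniformSubset n)

/-! ### Joint moments of the indicators of `A ⊆ S` for a uniformly random set `S` -/


/-! Each indicator of `A ⊆ S` is scaled to have mean one. A central moment of the subcube count is
then, up to a power of two, the sum over `k`-tuples of subcubes of the mean of the product of the
centred indicators (`avg_centered_pow`). For `k = 3` this mean is a joint cumulant. For `k = 4` it
is a joint cumulant plus three products of covariances, and each of these products sums to the
square of the covariance sum. The cumulants depend only on the sizes of the intersections, and they
vanish when the family splits into two parts with no point in common.

A tuple of `k` subcubes of the `n`-cube is a word of length `n` whose letters record, for one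
coordinate, which subcubes are free there and which values the others take. Every intersection size
is a product over the letters (`overlapCard_codeCube`), so it can be read off a product of integer
codes: exponents of some primes count common free coordinates, and other primes mark conflicts. A
letter with no free entry is either constant, with code 1, or disconnects the family and contributes
nothing. There are two constant letters and at most `k * r` letters with a free entry, so the sum
equals `2 ^ n * ∑ m ≤ k * r, choose n m * w m / 2 ^ m`, where the integers `w m` do not depend on
`n` (`sum_weight_eq`).

The integers `w m` are computed by a pruned enumeration of letter multiplicities, verified in
general by `getD_evalGroups` and run by kernel reduction. Expanding the binomial coefficients gives
the stated polynomials. -/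

/-- The average of `f S` over all subsets `S` of a finite type. -/
noncomputable def avg {α : Type*} [Fintype α] (f : Finset α → ℝ) : ℝ := (∑ S, f S) / 2 ^ Fintype.card α

/-- The indicator of `A ⊆ S`, scaled to have mean one. -/
noncomputable def scaledInd {α : Type*} [DecidableEq α] (A S : Finset α) : ℝ := if A ⊆ S then 2 ^ A.card else 0

theorem avg_add {α : Type*} [Fintype α] (f g : Finset α → ℝ) : avg (fun S => f S + g S) = avg f + avg g := by
  simp [avg, Finset.sum_add_distrib, add_div]

theorem avg_sub {α : Type*} [Fintype α] (f g : Finset α → ℝ) : avg (fun S => f S - g S) = avg f - avg g := by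
  simp [avg, Finset.sum_sub_distrib, sub_div]

theorem avg_const_mul {α : Type*} [Fintype α] (c : ℝ) (f : Finset α → ℝ) : avg (fun S => c * f S) = c * avg f := by
  simp [avg, ← Finset.mul_sum, mul_div_assoc]

theorem avg_const {α : Type*} [Fintype α] (c : ℝ) : avg (fun _ : Finset α => c) = c := by
  simp [avg]

theorem avg_sum {α ι : Type*} [Fintype α] (s : Finset ι)
    (f : ι → Finset α → ℝ) :
    avg (fun S => ∑ i ∈ s, f i S) = ∑ i ∈ s, avg (f i) := by
  simp only [avg, Finset.sum_div]
  rw [Finset.sum_comm]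

theorem avg_scaledInd {α : Type*} [Fintype α] [DecidableEq α] (A : Finset α) :
    avg (scaledInd A) = 1 := by
  have h : (Finset.univ.filter fun S => A ⊆ S) = Finset.Icc A Finset.univ := by
    ext S; simp
  have hA : A.card ≤ Fintype.card α := Finset.card_le_univ A
  simp only [avg, scaledInd]
  rw [← Finset.sum_filter, h, Finset.sum_const, Finset.card_Icc_finset (Finset.subset_univ A),
    Finset.card_univ, nsmul_eq_mul, div_eq_one_iff_eq (by positivity)]
  push_cast
  rw [← pow_add, Nat.sub_add_cancel hA]

/-- Since `|A| + |B| = |A ∩ B| + |A ∪ B|`, a product of scaled indicators collapses step by step to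
a constant times a single one, whose mean is one. -/
theorem scaledInd_mul {α : Type*} [DecidableEq α] (A B S : Finset α) :
    scaledInd A S * scaledInd B S = 2 ^ (A ∩ B).card * scaledInd (A ∪ B) S := by
  unfold scaledInd
  by_cases hA : A ⊆ S <;> by_cases hB : B ⊆ S <;> simp [hA, hB, Finset.union_subset_iff]
  rw [← pow_add, ← pow_add, add_comm (A ∩ B).card, Finset.card_union_add_card_inter]

theorem card_union_inter_add {α : Type*} [DecidableEq α] (A B C : Finset α) :
    ((A ∪ B) ∩ C).card + (A ∩ B ∩ C).card = (A ∩ C).card + (B ∩ C).card := by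
  rw [← Finset.card_union_add_card_inter (A ∩ C) (B ∩ C), Finset.union_inter_distrib_right,
    ← Finset.inter_inter_distrib_right]

theorem avg_scaledInd_two {α : Type*} [Fintype α] [DecidableEq α] (A B : Finset α) :
    avg (fun S => scaledInd A S * scaledInd B S) = 2 ^ (A ∩ B).card := by
  simp only [scaledInd_mul, avg_const_mul, avg_scaledInd, mul_one]

theorem avg_scaledInd_three {α : Type*} [Fintype α] [DecidableEq α] (A B C : Finset α) :
    avg (fun S => scaledInd A S * scaledInd B S * scaledInd C S) =
      2 ^ ((A ∩ B).card + (A ∩ C).card + (B ∩ C).card - (A ∩ B ∩ C).card) := by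
  simp only [scaledInd_mul, mul_assoc, avg_const_mul, avg_scaledInd, mul_one]
  rw [← pow_add]
  congr 1
  have := card_union_inter_add A B C
  omega

/-- The exponent is the sum of the four sizes minus the size of the union, rewritten by
inclusion–exclusion. It is nonnegative, so the natural subtraction loses nothing. -/
theorem avg_scaledInd_four {α : Type*} [Fintype α] [DecidableEq α] (A B C D : Finset α) :
    avg (fun S => scaledInd A S * scaledInd B S * scaledInd C S * scaledInd D S) =
      2 ^ ((A ∩ B).card + (A ∩ C).card + (B ∩ C).card + (A ∩ D).card + (B ∩ D).card
        + (C ∩ D).card + (A ∩ B ∩ C ∩ D).card - ((A ∩ B ∩ C).card + (A ∩ B ∩ D).card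
        + (A ∩ C ∩ D).card + (B ∩ C ∩ D).card)) := by
  simp only [scaledInd_mul, mul_assoc, avg_const_mul, avg_scaledInd, mul_one]
  rw [← pow_add, ← pow_add]
  congr 1
  have h1 := card_union_inter_add A B C
  have h2 := card_union_inter_add (A ∪ B) C D
  have h3 := card_union_inter_add A B D
  have h4 := card_union_inter_add A B (C ∩ D)
  simp only [← Finset.inter_assoc] at h4
  omega

theorem integral_uniformOn_univ_eq_avg {α : Type*} [Fintype α] (f : Finset α → ℝ) :
    ∫ S, f S ∂(ProbabilityTheory.uniformOn (Set.univ : Set (Finset α))) = avg f := by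
  classical
  rw [MeasureTheory.integral_fintype (MeasureTheory.Integrable.of_finite), avg, Finset.sum_div]
  refine Finset.sum_congr rfl fun S _ => ?_
  simp [MeasureTheory.Measure.real, ProbabilityTheory.uniformOn_univ, div_eq_inv_mul]

theorem centralMoment_uniformOn_univ {α : Type*} [Fintype α] (X : Finset α → ℝ) (k : ℕ) :
    ProbabilityTheory.centralMoment X k
        (ProbabilityTheory.uniformOn (Set.univ : Set (Finset α))) =
      avg fun S => (X S - avg X) ^ k := by
  simp only [ProbabilityTheory.centralMoment, Pi.pow_apply, Pi.sub_apply,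
    integral_uniformOn_univ_eq_avg]

/-- All sets have the same size `s`, so the factor `1 / 2 ^ s` comes out of `X - avg X` and leaves a
sum of centred scaled indicators, whose power expands over tuples. -/
theorem avg_centered_pow {α ι : Type*} [Fintype α] [DecidableEq α] [Fintype ι]
    (A : ι → Finset α) (s : ℕ) (hA : ∀ i, (A i).card = s) (X : Finset α → ℝ)
    (hX : ∀ S, X S = ∑ i, if A i ⊆ S then 1 else 0) (k : ℕ) :
    avg (fun S => (X S - avg X) ^ k) =
      (1 / 2 ^ s) ^ k * ∑ c : Fin k → ι, avg fun S => ∏ j, (scaledInd (A (c j)) S - 1) := by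
  have hX' : X = fun S => (1 / 2 ^ s) * ∑ i, scaledInd (A i) S := by
    funext S
    rw [hX, Finset.mul_sum]
    refine Finset.sum_congr rfl fun i _ => ?_
    unfold scaledInd
    split_ifs <;> simp [hA]
  have hmean : avg X = (1 / 2 ^ s) * ∑ _i : ι, 1 := by
    rw [hX', avg_const_mul, avg_sum]
    simp only [avg_scaledInd]
  rw [hmean, hX']
  simp only [← mul_sub, ← Finset.sum_sub_distrib, mul_pow, Fintype.sum_pow, avg_const_mul, avg_sum]

/-- Apply a function to a number that is brought to normal form first. -/
@[reducible] noncomputable def force {α : Type} (n : ℕ) (f : ℕ → α) : α :=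
  Nat.rec (f 0) (fun k _ => f (Nat.succ k)) n

theorem force_eq {α : Type} (n : ℕ) (f : ℕ → α) : force n f = f n := by
  cases n <;> rfl

/-- The number of points common to all `c i` with `i` in the bit mask `M`. -/
def overlapCard {α : Type*} [Fintype α] [DecidableEq α] {k : ℕ} (c : Fin k → Finset α) (M : ℕ) : ℕ :=
  (Finset.univ.filter fun x => ∀ i : Fin k, M.testBit i → x ∈ c i).card

/-- The joint cumulant of two scaled indicators, in terms of the overlap sizes. -/
noncomputable def cumulant₂ (z : ℕ → ℕ) : ℤ := Int.subNatNat (2 ^ z 3) 1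

/-- The joint cumulant of three scaled indicators, in terms of the overlap sizes. -/
noncomputable def cumulant₃ (z : ℕ → ℕ) : ℤ :=
  force (z 3) fun a => force (z 5) fun b => force (z 6) fun c =>
  Int.subNatNat (2 ^ (a + b + c - z 7) + 2) (2 ^ a + 2 ^ b + 2 ^ c)

/-- The joint cumulant of four scaled indicators, in terms of the overlap sizes. -/
noncomputable def cumulant₄ (z : ℕ → ℕ) : ℤ :=
  force (z 3) fun a => force (z 5) fun b => force (z 6) fun c =>
  force (z 9) fun d => force (z 10) fun e => force (z 12) fun f =>
  force (z 7) fun p => force (z 11) fun q => force (z 13) fun r => force (z 14) fun s =>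
  Int.subNatNat
    (2 ^ (a + b + c + d + e + f + z 15 - (p + q + r + s))
      + 2 * (2 ^ a + 2 ^ b + 2 ^ c + 2 ^ d + 2 ^ e + 2 ^ f))
    (2 ^ (a + b + c - p) + 2 ^ (a + d + e - q) + 2 ^ (b + d + f - r) + 2 ^ (c + e + f - s)
      + 6 + (2 ^ (a + f) + 2 ^ (b + e) + 2 ^ (c + d)))

/-! ### Mixed central moments of three and four indicators in terms of cumulants -/

section Cumulants

variable {α : Type*} [Fintype α] [DecidableEq α]

theorem cumulant₃_overlapCard (c : Fin 3 → Finset α) :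
    avg (fun S => ∏ j, (scaledInd (c j) S - 1)) = cumulant₃ (overlapCard c) := by
  have h3 : overlapCard c 3 = (c 0 ∩ c 1).card := by
    unfold overlapCard; congr 1; ext x
    simp [Fin.forall_fin_succ, Nat.testBit]
  have h5 : overlapCard c 5 = (c 0 ∩ c 2).card := by
    unfold overlapCard; congr 1; ext x
    simp [Fin.forall_fin_succ, Nat.testBit]
  have h6 : overlapCard c 6 = (c 1 ∩ c 2).card := by
    unfold overlapCard; congr 1; ext x
    simp [Fin.forall_fin_succ, Nat.testBit]
  have h7 : overlapCard c 7 = (c 0 ∩ c 1 ∩ c 2).card := by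
    unfold overlapCard; congr 1; ext x
    simp [Fin.forall_fin_succ, Nat.testBit]
  have h : (fun S => ∏ j, (scaledInd (c j) S - 1)) = fun S =>
      scaledInd (c 0) S * scaledInd (c 1) S * scaledInd (c 2) S
        - scaledInd (c 0) S * scaledInd (c 1) S - scaledInd (c 0) S * scaledInd (c 2) S
        - scaledInd (c 1) S * scaledInd (c 2) S
        + scaledInd (c 0) S + scaledInd (c 1) S + scaledInd (c 2) S - 1 := by
    funext S; rw [Fin.prod_univ_three]; ring
  rw [h]
  simp only [avg_add, avg_sub, avg_scaledInd_two, avg_scaledInd_three, avg_const,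
    cumulant₃, force_eq, Int.subNatNat_eq_coe, h3, h5, h6, h7, avg_scaledInd]
  push_cast
  ring

/-- The moment–cumulant formula: singletons have centred mean zero, so only the full block and the
three pairings survive. -/
theorem cumulant₄_overlapCard (c : Fin 4 → Finset α) :
    avg (fun S => ∏ j, (scaledInd (c j) S - 1)) = cumulant₄ (overlapCard c)
      + cumulant₂ (overlapCard ![c 0, c 1]) * cumulant₂ (overlapCard ![c 2, c 3])
      + cumulant₂ (overlapCard ![c 0, c 2]) * cumulant₂ (overlapCard ![c 1, c 3])
      + cumulant₂ (overlapCard ![c 0, c 3]) * cumulant₂ (overlapCard ![c 1, c 2]) := by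
  have h2 : ∀ a b : Finset α, overlapCard ![a, b] 3 = (a ∩ b).card := fun a b => by
    unfold overlapCard; congr 1; ext x
    simp [Fin.forall_fin_two, Nat.testBit]
  have h3 : overlapCard c 3 = (c 0 ∩ c 1).card := by
    unfold overlapCard; congr 1; ext x
    simp [Fin.forall_fin_succ, Nat.testBit]
  have h5 : overlapCard c 5 = (c 0 ∩ c 2).card := by
    unfold overlapCard; congr 1; ext x
    simp [Fin.forall_fin_succ, Nat.testBit]
  have h6 : overlapCard c 6 = (c 1 ∩ c 2).card := by
    unfold overlapCard; congr 1; ext x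
    simp [Fin.forall_fin_succ, Nat.testBit]
  have h9 : overlapCard c 9 = (c 0 ∩ c 3).card := by
    unfold overlapCard; congr 1; ext x
    simp [Fin.forall_fin_succ, Nat.testBit]
  have h10 : overlapCard c 10 = (c 1 ∩ c 3).card := by
    unfold overlapCard; congr 1; ext x
    simp [Fin.forall_fin_succ, Nat.testBit]
  have h12 : overlapCard c 12 = (c 2 ∩ c 3).card := by
    unfold overlapCard; congr 1; ext x
    simp [Fin.forall_fin_succ, Nat.testBit]
  have h7 : overlapCard c 7 = (c 0 ∩ c 1 ∩ c 2).card := by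
    unfold overlapCard; congr 1; ext x
    simp [Fin.forall_fin_succ, Nat.testBit]
  have h11 : overlapCard c 11 = (c 0 ∩ c 1 ∩ c 3).card := by
    unfold overlapCard; congr 1; ext x
    simp [Fin.forall_fin_succ, Nat.testBit]
  have h13 : overlapCard c 13 = (c 0 ∩ c 2 ∩ c 3).card := by
    unfold overlapCard; congr 1; ext x
    simp [Fin.forall_fin_succ, Nat.testBit]
  have h14 : overlapCard c 14 = (c 1 ∩ c 2 ∩ c 3).card := by
    unfold overlapCard; congr 1; ext x
    simp [Fin.forall_fin_succ, Nat.testBit]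
  have h15 : overlapCard c 15 = (c 0 ∩ c 1 ∩ c 2 ∩ c 3).card := by
    unfold overlapCard; congr 1; ext x
    simp [Fin.forall_fin_succ, Nat.testBit]
  have h : (fun S => ∏ j, (scaledInd (c j) S - 1)) = fun S =>
      scaledInd (c 0) S * scaledInd (c 1) S * scaledInd (c 2) S * scaledInd (c 3) S
        - scaledInd (c 0) S * scaledInd (c 1) S * scaledInd (c 2) S
        - scaledInd (c 0) S * scaledInd (c 1) S * scaledInd (c 3) S
        - scaledInd (c 0) S * scaledInd (c 2) S * scaledInd (c 3) S
        - scaledInd (c 1) S * scaledInd (c 2) S * scaledInd (c 3) S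
        + scaledInd (c 0) S * scaledInd (c 1) S + scaledInd (c 0) S * scaledInd (c 2) S
        + scaledInd (c 1) S * scaledInd (c 2) S + scaledInd (c 0) S * scaledInd (c 3) S
        + scaledInd (c 1) S * scaledInd (c 3) S + scaledInd (c 2) S * scaledInd (c 3) S
        - scaledInd (c 0) S - scaledInd (c 1) S - scaledInd (c 2) S - scaledInd (c 3) S + 1 := by
    funext S; rw [Fin.prod_univ_four]; ring
  rw [h]
  simp only [avg_add, avg_sub, avg_scaledInd_two, avg_scaledInd_three, avg_scaledInd_four, avg_const,
    cumulant₂, cumulant₄, force_eq, Int.subNatNat_eq_coe, h2, h3, h5, h6, h7, h9, h10, h11, h12,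
    h13, h14, h15, avg_scaledInd]
  push_cast
  ring

end Cumulants

/-! ### Evaluation of the weight sums over words of coordinate types -/

/-- The shift `G ↦ (z ↦ G (z * a))` on functions of a multiplicative state. -/
def shift : ℕ →* Module.End ℤ (ℕ → ℤ) where
  toFun a := LinearMap.funLeft ℤ ℤ (· * a)
  map_one' := by ext; simp [LinearMap.funLeft_apply]
  map_mul' a b := by
    refine LinearMap.ext fun G => funext fun z => ?_
    simp [LinearMap.funLeft_apply, mul_assoc]

theorem shift_apply (a : ℕ) (G : ℕ → ℤ) (z : ℕ) : shift a G z = G (z * a) := rfl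

/-- Commutation is what makes the order of letters irrelevant: powers of a sum of shifts obey the
binomial theorem, and words can be counted by multiplicities. -/
theorem shift_commute (a b : ℕ) : Commute (shift a) (shift b) := by
  rw [commute_iff_eq, ← map_mul, ← map_mul, mul_comm]

/-- The weighted sum of the shifts by the entries of a list of pairs (weight, state). -/
def shiftSum (ts : List (ℕ × ℕ)) : Module.End ℤ (ℕ → ℤ) :=
  (ts.map fun t => (t.1 : ℤ) • shift t.2).sum

theorem shiftSum_nil : shiftSum [] = 0 := rfl

theorem shiftSum_cons (t : ℕ × ℕ) (ts : List (ℕ × ℕ)) :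
    shiftSum (t :: ts) = (t.1 : ℤ) • shift t.2 + shiftSum ts := rfl

theorem shiftSum_append (ts us : List (ℕ × ℕ)) :
    shiftSum (ts ++ us) = shiftSum ts + shiftSum us := by
  simp [shiftSum]

theorem shift_commute_shiftSum (a : ℕ) (ts : List (ℕ × ℕ)) : Commute (shift a) (shiftSum ts) := by
  induction ts with
  | nil => exact Commute.zero_right _
  | cons t ts ih => exact ((shift_commute a t.2).smul_right _).add_right ih

theorem shiftSum_apply (ts : List (ℕ × ℕ)) (G : ℕ → ℤ) (z : ℕ) :
    shiftSum ts G z = (ts.map fun t => (t.1 : ℤ) * G (z * t.2)).sum := by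
  induction ts with
  | nil => rfl
  | cons t ts ih => simp [shiftSum_cons, shift_apply, ih]

theorem shiftSum_cons_pow_apply (w a : ℕ) (ts : List (ℕ × ℕ)) (j : ℕ) (F : ℕ → ℤ) (z : ℕ) :
    (shiftSum ((w, a) :: ts) ^ j) F z =
      ∑ s ∈ Finset.range (j + 1), (j.choose s : ℤ) * w ^ s * (shiftSum ts ^ (j - s)) F (z * a ^ s) := by
  rw [shiftSum_cons, ((shift_commute_shiftSum a ts).smul_left _).add_pow, LinearMap.sum_apply,
    Finset.sum_apply]
  refine Finset.sum_congr rfl fun s _ => ?_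
  rw [← nsmul_eq_mul', LinearMap.smul_apply, smul_pow, ← map_pow, smul_mul_assoc,
    LinearMap.smul_apply, Module.End.mul_apply, Pi.smul_apply, Pi.smul_apply, shift_apply]
  simp only [nsmul_eq_mul, smul_eq_mul]
  ring

/-- This is the justification of all pruning. A property of states that persists under
multiplication by the remaining letters and forces weight zero kills the whole branch. -/
theorem shiftSum_pow_apply_eq_zero {P : ℕ → Prop} {ts : List (ℕ × ℕ)} {F : ℕ → ℤ}
    (hF : ∀ z, P z → F z = 0) (hP : ∀ z, P z → ∀ t ∈ ts, P (z * t.2)) (j : ℕ) (z : ℕ) (hz : P z) :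
    (shiftSum ts ^ j) F z = 0 := by
  induction j generalizing z with
  | zero => exact hF z hz
  | succ j ih =>
    rw [pow_succ', Module.End.mul_apply, shiftSum_apply]
    refine List.sum_eq_zero fun x hx => ?_
    obtain ⟨t, ht, rfl⟩ := List.mem_map.1 hx
    rw [ih _ (hP z hz t ht), mul_zero]

/-- Whether some entry of the list divides `N`. -/
noncomputable def divAny (D : List ℕ) (N : ℕ) : Bool :=
  List.rec false (fun b _ ih => Bool.rec ih true (Nat.beq (Nat.mod N b) 0)) D

theorem divAny_iff (D : List ℕ) (N : ℕ) : divAny D N = true ↔ ∃ d ∈ D, d ∣ N := by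
  induction D with
  | nil => simp [divAny]
  | cons b D ih =>
    change (Bool.rec (divAny D N) true (Nat.beq (Nat.mod N b) 0) : Bool) = true ↔ _
    rw [List.exists_mem_cons_iff, ← ih, Nat.dvd_iff_mod_eq_zero]
    change _ ↔ Nat.mod N b = 0 ∨ _
    cases h : Nat.beq (Nat.mod N b) 0
    · have : Nat.mod N b ≠ 0 := fun h' => by simp [h'] at h
      simp [this]
    · simp [Nat.eq_of_beq_eq_true h]

/-- Addition of coefficient lists. -/
noncomputable def addCoeffs (l : List ℤ) : List ℤ → List ℤ :=
  List.rec (fun l' => l')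
    (fun a _ ih l' => List.rec (a :: ih []) (fun b t _ => Int.add a b :: ih t) l') l

theorem getD_addCoeffs (l l' : List ℤ) (j : ℕ) :
    (addCoeffs l l').getD j 0 = l.getD j 0 + l'.getD j 0 := by
  induction l generalizing l' j with
  | nil => simp [addCoeffs]
  | cons a l ih =>
    cases l' with
    | nil =>
      change (a :: addCoeffs l []).getD j 0 = _
      cases j
      · simp
      · simpa using ih [] _
    | cons b t =>
      change (Int.add a b :: addCoeffs l t).getD j 0 = _
      cases j
      · rfl
      · simp only [List.getD_cons_succ, ih]

/-- Run the evaluator `G` after each possible number of uses of the type `(w, a)`. -/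
noncomputable def evalUses (D : List ℕ) (G : ℕ → ℕ → ℕ → ℕ → List ℤ) (w a f : ℕ) :
    ℕ → ℕ → ℕ → ℕ → List ℤ :=
  Nat.rec (fun _ m c z => G 0 m c z) (fun f ih i m c z =>
    force (Nat.mul z a) fun z' =>
      Bool.rec
        (addCoeffs (G (Nat.succ f) m c z)
          (force (Nat.div (Nat.mul (Nat.mul c w) (Nat.succ m)) (Nat.succ i)) fun c' =>
            0 :: ih (Nat.succ i) (Nat.succ m) c' z'))
        (G (Nat.succ f) m c z) (divAny D z')) f

theorem evalUses_succ (D : List ℕ) (G : ℕ → ℕ → ℕ → ℕ → List ℤ) (w a f i m c z : ℕ) :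
    evalUses D G w a (f + 1) i m c z = force (z * a) fun z' =>
      Bool.rec
        (addCoeffs (G (f + 1) m c z) (force (c * w * (m + 1) / (i + 1)) fun c' =>
          0 :: evalUses D G w a f (i + 1) (m + 1) c' z'))
        (G (f + 1) m c z) (divAny D z') := rfl

/-- Run the evaluator `G` after each possible choice of multiplicities for the types in `ts`. -/
noncomputable def evalTypes (D : List ℕ) (G : ℕ → ℕ → ℕ → ℕ → List ℤ) (ts : List (ℕ × ℕ)) :
    ℕ → ℕ → ℕ → ℕ → List ℤ :=
  List.rec G (fun t _ ih f m c z => evalUses D ih t.1 t.2 f 0 m c z) ts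

/-- The list of the sums of `F` over the words of length `j` in the types of the groups `gs`,
for `j ≤ f`. States divisible by a member of `D` are discarded, as are the states not divisible
by `g.1` after the group `g` has been treated. -/
noncomputable def evalGroups (D : List ℕ) (F : ℕ → ℤ) (gs : List (ℕ × List (ℕ × ℕ))) :
    ℕ → ℕ → ℕ → ℕ → List ℤ :=
  List.rec (fun _ _ c z => [c * F z])
    (fun g _ ih => evalTypes D
      (fun f m c z => Bool.rec [] (ih f m c z) (Nat.beq (Nat.mod z g.1) 0)) g.2) gs

/-- The evaluator `G` computes the powers of the operator of `ts` applied to `F`. -/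
def Evaluates (F : ℕ → ℤ) (G : ℕ → ℕ → ℕ → ℕ → List ℤ) (ts : List (ℕ × ℕ)) : Prop :=
  ∀ f m c z j, j ≤ f →
    (G f m c z).getD j 0 = c * ((m + j).choose j : ℤ) * (shiftSum ts ^ j) F z

/-- Both sides are the trinomial coefficient of `(m, s, t)`. The left side chooses positions one
letter type at a time. -/
theorem choose_mul_choose_shift (m s t : ℕ) :
    (m + s).choose s * (m + (s + t)).choose t = (m + (s + t)).choose (s + t) * (s + t).choose s := by
  have h := Nat.choose_mul (n := m + (s + t)) (k := s + t) (s := t) (by omega)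
  rw [show m + (s + t) - t = m + s by omega, show s + t - t = s by omega] at h
  rw [Nat.choose_symm_add, h, mul_comm]

/-- Invariant of the loop after `i` uses of the current letter: the coefficient has absorbed the
choice of their positions and the weight `w ^ i`. The sum runs over the number `s` of further uses.
-/
theorem getD_evalUses {D : List ℕ} {F : ℕ → ℤ} {G : ℕ → ℕ → ℕ → ℕ → List ℤ} {ts : List (ℕ × ℕ)}
    (hF : ∀ d ∈ D, ∀ z, d ∣ z → F z = 0) (hG : Evaluates F G ts) (w a m c : ℕ) :
    ∀ f i j z, j ≤ f →
      (evalUses D G w a f i (m + i) (c * (m + i).choose i * w ^ i) z).getD j 0 =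
        ∑ s ∈ Finset.range (j + 1), (c : ℤ) * (m + i + s).choose (i + s) * w ^ (i + s) *
          (m + i + j).choose (j - s) * (shiftSum ts ^ (j - s)) F (z * a ^ s) := by
  intro f
  induction f with
  | zero =>
    intro i j z hj
    obtain rfl : j = 0 := by omega
    change (G 0 _ _ z).getD 0 0 = _
    rw [hG _ _ _ _ _ le_rfl]
    simp
  | succ f ih =>
    intro i j z hj
    have hstep : evalUses D G w a (f + 1) i (m + i) (c * (m + i).choose i * w ^ i) z =
        if divAny D (z * a) then G (f + 1) (m + i) (c * (m + i).choose i * w ^ i) z else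
          addCoeffs (G (f + 1) (m + i) (c * (m + i).choose i * w ^ i) z)
            (0 :: evalUses D G w a f (i + 1) (m + (i + 1))
              (c * (m + (i + 1)).choose (i + 1) * w ^ (i + 1)) (z * a)) := by
      -- The division in the evaluator is exact: `(i + 1) * choose (m + i + 1) (i + 1) = (m + i + 1)
      -- * choose (m + i) i`.
      have hc : c * (m + i).choose i * w ^ i * w * (m + i + 1) / (i + 1) =
          c * (m + (i + 1)).choose (i + 1) * w ^ (i + 1) := by
        apply Nat.div_eq_of_eq_mul_left (show 0 < i + 1 by omega)
        have := Nat.add_one_mul_choose_eq (m + i) i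
        rw [← add_assoc, pow_succ]
        linear_combination c * w ^ i * w * this
      rw [← hc]
      rw [evalUses_succ, force_eq, force_eq]
      cases divAny D (z * a) <;> rfl
    have hsum := Finset.sum_range_succ' (fun s => (c : ℤ) * (m + i + s).choose (i + s) *
      w ^ (i + s) * (m + i + j).choose (j - s) * (shiftSum ts ^ (j - s)) F (z * a ^ s)) j
    rw [hstep, hsum]
    have h0 : (G (f + 1) (m + i) (c * (m + i).choose i * w ^ i) z).getD j 0 =
        (c : ℤ) * (m + i + 0).choose (i + 0) * w ^ (i + 0) * (m + i + j).choose (j - 0) *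
          (shiftSum ts ^ (j - 0)) F (z * a ^ 0) := by
      rw [hG _ _ _ _ _ hj]
      simp
    split_ifs with hd
    -- One more use reaches a dead state, and so do all later uses; only the term `s = 0` remains.
    · obtain ⟨d, hd, hdz⟩ := (divAny_iff _ _).1 hd
      rw [h0, Finset.sum_eq_zero, zero_add]
      intro s _
      rw [shiftSum_pow_apply_eq_zero (P := (d ∣ ·)) (hF d hd)
        (fun z hz t _ => hz.mul_right _), mul_zero]
      rw [pow_succ', ← mul_assoc]
      exact hdz.mul_right _
    · rw [getD_addCoeffs, h0, add_comm]
      congr 1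
      cases j with
      | zero => simp
      | succ j =>
        rw [List.getD_cons_succ, ih _ _ _ (by omega)]
        refine Finset.sum_congr rfl fun s _ => ?_
        rw [show m + (i + 1) + s = m + i + (s + 1) by omega, show i + 1 + s = i + (s + 1) by omega,
          show m + (i + 1) + j = m + i + (j + 1) by omega, show j + 1 - (s + 1) = j - s by omega,
          pow_succ' a, ← mul_assoc z]

theorem Evaluates.cons {D : List ℕ} {F : ℕ → ℤ} {G : ℕ → ℕ → ℕ → ℕ → List ℤ} {ts : List (ℕ × ℕ)}
    (hF : ∀ d ∈ D, ∀ z, d ∣ z → F z = 0) (hG : Evaluates F G ts) (w a : ℕ) :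
    Evaluates F (fun f m c z => evalUses D G w a f 0 m c z) ((w, a) :: ts) := by
  intro f m c z j hj
  have h := getD_evalUses hF hG w a m c f 0 j z hj
  simp only [add_zero, Nat.choose_zero_right, mul_one, pow_zero, zero_add] at h
  rw [h, shiftSum_cons_pow_apply, Finset.mul_sum]
  refine Finset.sum_congr rfl fun s hs => ?_
  obtain ⟨t, rfl⟩ := Nat.exists_eq_add_of_le (Nat.lt_succ_iff.1 (Finset.mem_range.1 hs))
  have := congrArg (Nat.cast : ℕ → ℤ) (choose_mul_choose_shift m s t)
  push_cast at this
  rw [Nat.add_sub_cancel_left]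
  linear_combination (c : ℤ) * w ^ s * (shiftSum ts ^ t) F (z * a ^ s) * this

theorem Evaluates.evalTypes {D : List ℕ} {F : ℕ → ℤ} {G : ℕ → ℕ → ℕ → ℕ → List ℤ}
    {us : List (ℕ × ℕ)} (hF : ∀ d ∈ D, ∀ z, d ∣ z → F z = 0) (hG : Evaluates F G us)
    (ts : List (ℕ × ℕ)) : Evaluates F (evalTypes D G ts) (ts ++ us) := by
  induction ts with
  | nil => exact hG
  | cons t ts ih => exact ih.cons hF t.1 t.2

/-- If the remaining codes are coprime to `b`, a state not divisible by `b` never becomes so. All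
its sums are zero, as are the default entries of the empty list. -/
theorem Evaluates.test {F : ℕ → ℤ} {G : ℕ → ℕ → ℕ → ℕ → List ℤ} {ts : List (ℕ × ℕ)}
    (hG : Evaluates F G ts) (b : ℕ) (hb : ∀ z, ¬ b ∣ z → F z = 0)
    (hts : ∀ t ∈ ts, Nat.Coprime b t.2) :
    Evaluates F (fun f m c z => Bool.rec [] (G f m c z) (Nat.beq (Nat.mod z b) 0)) ts := by
  intro f m c z j hj
  beta_reduce
  cases h : Nat.beq (Nat.mod z b) 0
  · have hz : ¬ b ∣ z := fun hz => by
      rw [Nat.dvd_iff_mod_eq_zero] at hz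
      change Nat.mod z b = 0 at hz
      simp [hz] at h
    rw [shiftSum_pow_apply_eq_zero (P := fun z => ¬ b ∣ z) hb
      (fun z hz t ht h => hz ((hts t ht).dvd_of_dvd_mul_right h)) _ _ hz]
    simp
  · exact hG f m c z j hj

/-- Each group test is coprime to all the types of the later groups. -/
def GroupsCoprime (gs : List (ℕ × List (ℕ × ℕ))) : Prop :=
  gs.Pairwise fun g h => ∀ t ∈ h.2, Nat.Coprime g.1 t.2

theorem evaluates_evalGroups {D : List ℕ} {F : ℕ → ℤ} (hF : ∀ d ∈ D, ∀ z, d ∣ z → F z = 0)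
    (gs : List (ℕ × List (ℕ × ℕ))) (hb : ∀ g ∈ gs, ∀ z, ¬ g.1 ∣ z → F z = 0)
    (hgs : GroupsCoprime gs) :
    Evaluates F (evalGroups D F gs) (gs.flatMap Prod.snd) := by
  induction gs with
  | nil =>
    intro f m c z j hj
    change [(c : ℤ) * F z].getD j 0 = _
    cases j with
    | zero => simp
    | succ j => simp [shiftSum_nil]
  | cons g gs ih =>
    obtain ⟨hg, hgs⟩ := List.pairwise_cons.1 hgs
    refine Evaluates.evalTypes hF (Evaluates.test (ih (fun g' h' => hb g' (.tail _ h')) hgs) g.1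
      (hb g (.head _)) ?_) g.2
    intro t ht
    obtain ⟨h, hh, ht⟩ := List.mem_flatMap.1 ht
    exact hg h hh t ht

theorem getD_evalGroups {D : List ℕ} {F : ℕ → ℤ} (hF : ∀ d ∈ D, ∀ z, d ∣ z → F z = 0)
    (gs : List (ℕ × List (ℕ × ℕ))) (hb : ∀ g ∈ gs, ∀ z, ¬ g.1 ∣ z → F z = 0)
    (hgs : GroupsCoprime gs) {f j : ℕ} (hj : j ≤ f) :
    (shiftSum (gs.flatMap Prod.snd) ^ j) F 1 = (evalGroups D F gs f 0 1 1).getD j 0 := by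
  rw [evaluates_evalGroups hF gs hb hgs f 0 1 1 j hj]
  simp

/-! ### Encoding of the overlap sizes of a family of subcubes by prime exponents -/

/-- Distinct primes used as markers. -/
def primeMark (i : ℕ) : ℕ :=
  [2, 3, 5, 7, 11, 13, 17, 19, 23, 29, 31, 37, 41, 43, 47, 53, 59, 61, 67, 71, 73, 79, 83, 89, 97,
    101, 103, 107, 109, 113, 127, 131].getD i 1

theorem primeMark_prime {i : ℕ} (hi : i < 32) : (primeMark i).Prime := by
  interval_cases i <;> norm_num [primeMark]

theorem primeMark_injOn : Set.InjOn primeMark (Finset.range 32) := by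
  have h : ∀ i < 32, ∀ j < 32, primeMark i = primeMark j → i = j := by decide
  intro i hi j hj
  exact h i (by simpa using hi) j (by simpa using hj)

/-- The number of values of a coordinate admitted by all the subcubes with index in the bit mask
`M`, where `t i` is the value of this coordinate in the `i`-th subcube (`none` if it is free). -/
def localCount {k : ℕ} (t : Fin k → Option Bool) (M : ℕ) : ℕ :=
  (Finset.univ.filter fun b : Bool => ∀ i : Fin k, M.testBit i → t i = none ∨ t i = some b).card

/-- The exponent of `primeMark i` in the code of a coordinate type: a mark below `16` records a
common free coordinate, a mark above `16` a conflict. -/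
def markExponent {k : ℕ} (t : Fin k → Option Bool) (i : ℕ) : ℕ :=
  if i < 16 then (if 0 < i ∧ i < 2 ^ k ∧ localCount t i = 2 then 1 else 0)
  else (if 16 < i ∧ i < 16 + 2 ^ k ∧ localCount t (i - 16) = 0 then 1 else 0)

/-- The code of a coordinate type. -/
def typeCode {k : ℕ} (t : Fin k → Option Bool) : ℕ :=
  ∏ i ∈ Finset.range 32, primeMark i ^ markExponent t i

/-- The multiplicity of `p` in `N`, if it is at most `f`. -/
noncomputable def multUpTo (p f : ℕ) : ℕ → ℕ :=
  Nat.rec (fun _ => 0)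
    (fun _ ih N => Bool.rec 0 (Nat.succ (ih (Nat.div N p))) (Nat.beq (Nat.mod N p) 0)) f

/-- The overlap size for the mask `M` encoded in the state `N`. -/
noncomputable def stateOverlap (r N M : ℕ) : ℕ :=
  bif Nat.beq (Nat.mod N (primeMark (16 + M))) 0 then 0 else 2 ^ multUpTo (primeMark M) r N

/-- The divisors of the states in which every subcube has at least `r` free coordinates. -/
def starTests (k r : ℕ) : List ℕ := (List.range k).map fun i => primeMark (2 ^ i) ^ r

/-- The masks of the parts containing the index `0` of the splittings of `k` indices in two. -/
def splitMasks (k : ℕ) : List ℕ := (List.range (2 ^ k - 1)).filter fun A => A % 2 = 1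

/-- The mask `M` meets both `A` and its complement. -/
def Crosses (A M : ℕ) : Prop := M &&& A ≠ 0 ∧ M &&& A ≠ M

instance (A M : ℕ) : Decidable (Crosses A M) := inferInstanceAs (Decidable (_ ∧ _))

/-- Divisors of states in which a subcube has more than `r` free coordinates or the family of
subcubes splits into two parts without a common point. -/
def deadStates (k r : ℕ) : List ℕ :=
  ((List.range k).map fun i => primeMark (2 ^ i) ^ (r + 1)) ++
    (splitMasks k).map fun A =>
      ∏ M ∈ (Finset.range (2 ^ k)).filter (Crosses A), primeMark (16 + M)

/-- The weight of an encoded state. -/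
noncomputable def stateWeight (C D : List ℕ) (r : ℕ) (κ : (ℕ → ℕ) → ℤ) (N : ℕ) : ℤ :=
  bif C.all (fun b => Nat.beq (Nat.mod N b) 0) then
    (bif divAny D N then 0 else force N fun N => κ (stateOverlap r N)) else 0

/-- A function of the overlap sizes of `k` sets that depends only on these sizes and vanishes if
the family splits into two parts without a common point. -/
structure IsConnectedWeight (k : ℕ) (κ : (ℕ → ℕ) → ℤ) : Prop where
  congr : ∀ z z' : ℕ → ℕ, (∀ M, 0 < M → M < 2 ^ k → z M = z' M) → κ z = κ z'
  split : ∀ z : ℕ → ℕ, ∀ A ∈ splitMasks k, (∀ M < 2 ^ k, Crosses A M → z M = 0) → κ z = 0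

theorem localCount_le {k : ℕ} (t : Fin k → Option Bool) (M : ℕ) : localCount t M ≤ 2 :=
  Finset.card_le_univ _

theorem localCount_eq_two_iff {k : ℕ} (t : Fin k → Option Bool) (M : ℕ) :
    localCount t M = 2 ↔ ∀ i : Fin k, M.testBit i → t i = none := by
  have h : localCount t M = 2 ↔ (Finset.univ.filter fun b : Bool =>
      ∀ i : Fin k, M.testBit i → t i = none ∨ t i = some b) = Finset.univ := by
    rw [← Finset.card_eq_iff_eq_univ]; rfl
  rw [h, Finset.filter_eq_self]
  constructor
  · intro h i hi
    rcases h true (Finset.mem_univ _) i hi with h1 | h1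
    · exact h1
    · rcases h false (Finset.mem_univ _) i hi with h2 | h2
      · exact h2
      · simp [h1] at h2
  · exact fun h b _ i hi => Or.inl (h i hi)

theorem localCount_two_pow {k : ℕ} (t : Fin k → Option Bool) (i : Fin k) :
    localCount t (2 ^ (i : ℕ)) = 2 ↔ t i = none := by
  rw [localCount_eq_two_iff]
  simp only [Nat.testBit_two_pow, decide_eq_true_eq]
  exact ⟨fun h => h i rfl, fun h j hj => by rwa [← Fin.ext hj]⟩

theorem multUpTo_eq {p : ℕ} (hp : p.Prime) (f : ℕ) {N : ℕ} (hN : N ≠ 0)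
    (h : N.factorization p ≤ f) : multUpTo p f N = N.factorization p := by
  induction f generalizing N with
  | zero => exact (Nat.le_zero.1 h).symm
  | succ f ih =>
    change (Bool.rec 0 (Nat.succ (multUpTo p f (N / p))) (Nat.beq (N % p) 0) : ℕ) = _
    cases hb : Nat.beq (N % p) 0
    · have hd : ¬ p ∣ N := fun hd => by simp [Nat.mod_eq_zero_of_dvd hd] at hb
      exact (Nat.factorization_eq_zero_of_not_dvd hd).symm
    · have hd : p ∣ N := Nat.dvd_of_mod_eq_zero (Nat.eq_of_beq_eq_true hb)
      have h1 : 0 < N.factorization p := hp.factorization_pos_of_dvd hN hd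
      have h2 : (N / p).factorization p = N.factorization p - 1 := by
        rw [Nat.factorization_div hd, hp.factorization]; simp
      have h3 : N / p ≠ 0 := (Nat.div_pos (Nat.le_of_dvd (Nat.pos_of_ne_zero hN) hd) hp.pos).ne'
      change Nat.succ (multUpTo p f (N / p)) = _
      rw [ih h3 (by omega), h2]
      omega

section Decoding

variable {n k : ℕ} (c : Fin n → Fin k → Option Bool)

theorem prod_typeCode : ∏ j, typeCode (c j) =
    ∏ i ∈ Finset.range 32, primeMark i ^ ∑ j, markExponent (c j) i := by
  simp only [typeCode, ← Finset.prod_pow_eq_pow_sum]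
  exact Finset.prod_comm

theorem prod_typeCode_ne_zero : ∏ j, typeCode (c j) ≠ 0 := by
  rw [prod_typeCode, Finset.prod_ne_zero_iff]
  exact fun i hi => pow_ne_zero _ (primeMark_prime (Finset.mem_range.1 hi)).ne_zero

theorem factorization_prod_typeCode {i : ℕ} (hi : i < 32) :
    (∏ j, typeCode (c j)).factorization (primeMark i) = ∑ j, markExponent (c j) i := by
  rw [prod_typeCode, Nat.factorization_prod fun i hi =>
    pow_ne_zero _ (primeMark_prime (Finset.mem_range.1 hi)).ne_zero, Finset.sum_apply']
  rw [Finset.sum_eq_single i]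
  · rw [(primeMark_prime hi).factorization_pow]; simp
  · intro j hj hji
    rw [(primeMark_prime (Finset.mem_range.1 hj)).factorization_pow, Finsupp.single_apply, if_neg]
    exact fun h => hji (primeMark_injOn (by simpa using hj) (by simpa using hi) h)
  · intro h; exact absurd (Finset.mem_range.2 hi) h

theorem factorization_free {M : ℕ} (hk : k ≤ 4) (h0 : 0 < M) (hM : M < 2 ^ k) :
    (∏ j, typeCode (c j)).factorization (primeMark M) =
      (Finset.univ.filter fun j => localCount (c j) M = 2).card := by
  have h16 : M < 16 := hM.trans_le (Nat.pow_le_pow_right (by norm_num) hk)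
  rw [factorization_prod_typeCode c (by omega), Finset.card_filter]
  simp [markExponent, h16, h0, hM]

theorem conflict_dvd_iff {M : ℕ} (hk : k ≤ 4) (h0 : 0 < M) (hM : M < 2 ^ k) :
    primeMark (16 + M) ∣ ∏ j, typeCode (c j) ↔ ∃ j, localCount (c j) M = 0 := by
  have h16 : M < 16 := hM.trans_le (Nat.pow_le_pow_right (by norm_num) hk)
  rw [(primeMark_prime (by omega)).dvd_iff_one_le_factorization (prod_typeCode_ne_zero c),
    factorization_prod_typeCode c (by omega), Nat.one_le_iff_ne_zero, ne_eq, Finset.sum_eq_zero_iff]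
  simp [markExponent, h0, hM]

theorem prod_localCount (M : ℕ) : ∏ j, localCount (c j) M =
    if ∃ j, localCount (c j) M = 0 then 0
      else 2 ^ (Finset.univ.filter fun j => localCount (c j) M = 2).card := by
  split_ifs with h
  · obtain ⟨j, hj⟩ := h
    exact Finset.prod_eq_zero (Finset.mem_univ j) hj
  · rw [← Finset.prod_const, Finset.prod_filter]
    refine Finset.prod_congr rfl fun j _ => ?_
    have h1 := localCount_le (c j) M
    have h2 : localCount (c j) M ≠ 0 := fun h' => h ⟨j, h'⟩
    split_ifs <;> omega

theorem free_two_pow (i : Fin k) : (Finset.univ.filter fun j => localCount (c j) (2 ^ (i : ℕ)) = 2) =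
    Finset.univ.filter fun j => c j i = none := by
  simp only [localCount_two_pow]

theorem stateOverlap_prod_typeCode {r M : ℕ} (hk : k ≤ 4) (h0 : 0 < M) (hM : M < 2 ^ k)
    (hr : ∀ i, (Finset.univ.filter fun j => c j i = none).card = r) :
    stateOverlap r (∏ j, typeCode (c j)) M = ∏ j, localCount (c j) M := by
  have h16 : M < 16 := hM.trans_le (Nat.pow_le_pow_right (by norm_num) hk)
  obtain ⟨i, hi⟩ : ∃ i : Fin k, M.testBit i := by
    obtain ⟨i, hi⟩ := Nat.exists_testBit_of_ne_zero h0.ne'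
    have : 2 ^ i < 2 ^ k := (Nat.ge_two_pow_of_testBit hi).trans_lt hM
    exact ⟨⟨i, (Nat.pow_lt_pow_iff_right (by norm_num)).1 this⟩, hi⟩
  -- A coordinate free for all subcubes in `M` is free for any one of them, so the cutoff `r` in
  -- `multUpTo` is never exceeded.
  have hle : (Finset.univ.filter fun j => localCount (c j) M = 2).card ≤ r := by
    rw [← hr i]
    exact Finset.card_le_card (Finset.monotone_filter_right _ fun j _ hj =>
      (localCount_eq_two_iff _ _).1 hj i hi)
  rw [prod_localCount, stateOverlap, multUpTo_eq (primeMark_prime (by omega))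
    r (prod_typeCode_ne_zero c) (by rwa [factorization_free c hk h0 hM]),
    factorization_free c hk h0 hM]
  simp only [← conflict_dvd_iff c hk h0 hM]
  cases hb : Nat.beq (Nat.mod (∏ j, typeCode (c j)) (primeMark (16 + M))) 0
  · have : ¬ primeMark (16 + M) ∣ ∏ j, typeCode (c j) := fun hd => by
      rw [Nat.dvd_iff_mod_eq_zero] at hd
      change Nat.mod _ _ = 0 at hd
      simp [hd] at hb
    simp [this]
  · simp [Nat.dvd_of_mod_eq_zero (Nat.eq_of_beq_eq_true hb)]

/-- The tests give at least `r` free coordinates in each subcube, and the first dead states exclude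
more than `r`. The other dead states only discard families on which `κ` vanishes by `split`. -/
theorem stateWeight_prod_typeCode {r : ℕ} {κ : (ℕ → ℕ) → ℤ} (hk : k ≤ 4)
    (hκ : IsConnectedWeight k κ) :
    stateWeight (starTests k r) (deadStates k r) r κ (∏ j, typeCode (c j)) =
      if ∀ i, (Finset.univ.filter fun j => c j i = none).card = r then
        κ fun M => ∏ j, localCount (c j) M else 0 := by
  set N := ∏ j, typeCode (c j) with hN
  have hpow : ∀ (i : Fin k) (s : ℕ), primeMark (2 ^ (i : ℕ)) ^ s ∣ N ↔
      s ≤ (Finset.univ.filter fun j => c j i = none).card := by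
    intro i s
    have h1 : 2 ^ (i : ℕ) < 2 ^ k := Nat.pow_lt_pow_right (by norm_num) i.2
    have h2 : 2 ^ k ≤ 2 ^ 4 := Nat.pow_le_pow_right (by norm_num) hk
    rw [(primeMark_prime (by omega)).pow_dvd_iff_le_factorization (prod_typeCode_ne_zero c),
      factorization_free c hk (by positivity) h1, free_two_pow]
  have hC : (starTests k r).all (fun b => Nat.beq (Nat.mod N b) 0) = true ↔
      ∀ i, r ≤ (Finset.univ.filter fun j => c j i = none).card := by
    simp only [starTests, List.all_map, List.all_eq_true, List.mem_range, Function.comp]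
    constructor
    · exact fun h i => (hpow i r).1 (Nat.dvd_of_mod_eq_zero (Nat.eq_of_beq_eq_true (h i i.2)))
    · intro h i hi
      rw [show Nat.mod N (primeMark (2 ^ i) ^ r) = 0 from
        Nat.mod_eq_zero_of_dvd ((hpow ⟨i, hi⟩ r).2 (h ⟨i, hi⟩))]
      rfl
  unfold stateWeight
  rw [force_eq]
  by_cases hr : ∀ i, (Finset.univ.filter fun j => c j i = none).card = r
  · rw [if_pos hr, hC.2 fun i => (hr i).ge, cond_true]
    have hz : κ (stateOverlap r N) = κ fun M => ∏ j, localCount (c j) M :=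
      hκ.congr _ _ fun M h0 hM => stateOverlap_prod_typeCode c hk h0 hM hr
    rw [hz]
    cases hD : divAny (deadStates k r) N
    · rfl
    · obtain ⟨d, hd, hdN⟩ := (divAny_iff _ _).1 hD
      rcases List.mem_append.1 hd with hd | hd
      · obtain ⟨i, hi, rfl⟩ := List.mem_map.1 hd
        have := (hpow ⟨i, List.mem_range.1 hi⟩ (r + 1)).1 hdN
        rw [hr] at this
        omega
      · obtain ⟨A, hA, rfl⟩ := List.mem_map.1 hd
        refine (hκ.split _ A hA fun M hM hAM => ?_).symm
        have h0 : 0 < M := Nat.pos_of_ne_zero fun h => hAM.1 (by simp [h])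
        rw [prod_localCount, if_pos]
        rw [← conflict_dvd_iff c hk h0 hM]
        exact (Finset.dvd_prod_of_mem (fun M => primeMark (16 + M))
          (Finset.mem_filter.2 ⟨Finset.mem_range.2 hM, hAM⟩)).trans hdN
  · rw [if_neg hr]
    cases hb : (starTests k r).all (fun b => Nat.beq (Nat.mod N b) 0)
    · rfl
    · rw [cond_true]
      have hge := hC.1 hb
      obtain ⟨i, hi⟩ := not_forall.1 hr
      have hd : divAny (deadStates k r) N = true := (divAny_iff _ _).2
        ⟨primeMark (2 ^ (i : ℕ)) ^ (r + 1), List.mem_append_left _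
          (List.mem_map.2 ⟨i, List.mem_range.2 i.2, rfl⟩),
          (hpow i (r + 1)).2 (by have := hge i; omega)⟩
      rw [hd, cond_true]

end Decoding

theorem stateWeight_eq_zero_of_dead {C D : List ℕ} {r : ℕ} {κ : (ℕ → ℕ) → ℤ} :
    ∀ d ∈ D, ∀ N, d ∣ N → stateWeight C D r κ N = 0 := by
  intro d hd N hdN
  rw [stateWeight, (divAny_iff D N).2 ⟨d, hd, hdN⟩, cond_true]
  exact Bool.cond_self _ _

theorem stateWeight_eq_zero_of_test {C D : List ℕ} {r : ℕ} {κ : (ℕ → ℕ) → ℤ} :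
    ∀ b ∈ C, ∀ N, ¬ b ∣ N → stateWeight C D r κ N = 0 := by
  intro b hb N hbN
  rw [stateWeight]
  cases h : C.all (fun b => Nat.beq (Nat.mod N b) 0)
  · rfl
  · exact absurd (Nat.dvd_of_mod_eq_zero (Nat.eq_of_beq_eq_true (List.all_eq_true.1 h b hb))) hbN

/-! ### Sums over words of coordinate types -/

/-- Each letter multiplies the state by its code, so summing over words iterates one transfer
operator. -/
theorem sum_prod_eq_pow_shift {τ : Type*} [Fintype τ] (φ : τ → ℕ) (F : ℕ → ℤ) (n z : ℕ) :
    ∑ c : Fin n → τ, F (z * ∏ j, φ (c j)) = ((∑ t, shift (φ t)) ^ n) F z := by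
  induction n generalizing z with
  | zero => simp
  | succ n ih =>
    rw [← (Fin.consEquiv fun _ => τ).sum_comp, Fintype.sum_prod_type, pow_succ',
      Module.End.mul_apply, LinearMap.sum_apply, Finset.sum_apply]
    refine Finset.sum_congr rfl fun t _ => ?_
    rw [shift_apply, ← ih]
    refine Finset.sum_congr rfl fun c _ => ?_
    simp [Fin.consEquiv, Fin.prod_univ_succ, mul_assoc]

theorem shiftSum_append_pow_apply {D : List ℕ} {F : ℕ → ℤ} (hF : ∀ d ∈ D, ∀ z, d ∣ z → F z = 0)
    (us ts : List (ℕ × ℕ)) (hus : ∀ u ∈ us, divAny D u.2 = true) (n z : ℕ) :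
    (shiftSum (us ++ ts) ^ n) F z = (shiftSum ts ^ n) F z := by
  induction us generalizing n z with
  | nil => rfl
  | cons u us ih =>
    obtain ⟨d, hd, hdu⟩ := (divAny_iff _ _).1 (hus u (.head _))
    rw [List.cons_append, shiftSum_cons_pow_apply, Finset.sum_range_succ', Finset.sum_eq_zero]
    · simp [ih fun u hu => hus u (.tail _ hu)]
    · intro s _
      rw [shiftSum_pow_apply_eq_zero (P := (d ∣ ·)) (hF d hd) (fun z hz t _ => hz.mul_right _),
        mul_zero]
      exact (hdu.trans (dvd_pow_self _ s.succ_ne_zero)).mul_left _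

theorem multiset_sum_shift_eq_shiftSum {s : Multiset ℕ} {ts : List (ℕ × ℕ)}
    (h : s = (ts.flatMap fun t => List.replicate t.1 t.2 : List ℕ)) :
    (s.map shift).sum = shiftSum ts := by
  subst h
  induction ts with
  | nil => rfl
  | cons t ts ih =>
    rw [List.flatMap_cons, ← Multiset.coe_add, Multiset.map_add, Multiset.sum_add, ih, shiftSum_cons]
    simp

/-- The coordinate types in which some subcube is free. -/
def freeTypes (k : ℕ) : Finset (Fin k → Option Bool) :=
  Finset.univ.filter fun t => ∃ i, t i = none

/-- The list `ts` collects the codes of the types with a free coordinate; the codes of the other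
types are two ones and dead states. -/
structure IsTypeList (k r : ℕ) (ts : List (ℕ × ℕ)) : Prop where
  free : (freeTypes k).val.map typeCode = (ts.flatMap fun t => List.replicate t.1 t.2 : List ℕ)
  fixed : ((freeTypes k)ᶜ.filter fun t => typeCode t = 1).card = 2
  dead : ∀ t ∈ (freeTypes k)ᶜ, typeCode t ≠ 1 → ∃ d ∈ deadStates k r, d ∣ typeCode t

section WordSums

variable {k r : ℕ} {κ : (ℕ → ℕ) → ℤ} {ts : List (ℕ × ℕ)}

theorem sum_shift_freeTypes (hts : IsTypeList k r ts) :
    ∑ t ∈ freeTypes k, shift (typeCode t) = shiftSum ts := by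
  rw [← multiset_sum_shift_eq_shiftSum hts.free, Multiset.map_map]
  rfl

/-- The two constant letters act as twice the identity, and the other letters without a free entry
are collected in `us`, all dead. -/
theorem sum_shift_typeCode (hts : IsTypeList k r ts) :
    ∃ us : List (ℕ × ℕ), (∀ u ∈ us, divAny (deadStates k r) u.2 = true) ∧
      ∑ t : Fin k → Option Bool, shift (typeCode t) = shiftSum (us ++ (2, 1) :: ts) := by
  set s := (freeTypes k)ᶜ.filter fun t => ¬ typeCode t = 1 with hs
  refine ⟨s.toList.map fun t => (1, typeCode t), ?_, ?_⟩
  · intro u hu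
    obtain ⟨t, ht, rfl⟩ := List.mem_map.1 hu
    obtain ⟨ht, h1⟩ := Finset.mem_filter.1 (Finset.mem_toList.1 ht)
    exact (divAny_iff _ _).2 (hts.dead t ht h1)
  · have h1 : ∑ t ∈ (freeTypes k)ᶜ.filter (fun t => typeCode t = 1), shift (typeCode t) =
        (2 : ℤ) • shift 1 := by
      rw [Finset.sum_congr rfl fun t ht => by rw [(Finset.mem_filter.1 ht).2], Finset.sum_const,
        hts.fixed]
      exact (natCast_zsmul _ 2).symm
    have h2 : ∑ t ∈ s, shift (typeCode t) =
        shiftSum (s.toList.map fun t => (1, typeCode t)) := by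
      rw [← Finset.sum_map_toList, shiftSum, List.map_map]
      simp [Function.comp_def]
    rw [shiftSum_append, shiftSum_cons, ← sum_shift_freeTypes hts, ← h2, Nat.cast_two, ← h1,
      ← Finset.sum_add_sum_compl (freeTypes k),
      ← Finset.sum_filter_add_sum_filter_not (freeTypes k)ᶜ fun t => typeCode t = 1, ← hs]
    abel

/-- The sum of the weights over the words of length `m` in the types with a free coordinate. -/
noncomputable def wordSum (k r : ℕ) (κ : (ℕ → ℕ) → ℤ) (ts : List (ℕ × ℕ)) (m : ℕ) : ℤ :=
  (shiftSum ts ^ m) (stateWeight (starTests k r) (deadStates k r) r κ) 1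

/-- Double counting of pairs (position, free subcube): there is at least one per position, and
exactly `k * r` in all for a word of nonzero weight. -/
theorem wordSum_eq_zero (hk : k ≤ 4) (hκ : IsConnectedWeight k κ) (hts : IsTypeList k r ts) {m : ℕ}
    (hm : k * r < m) : wordSum k r κ ts m = 0 := by
  have h := sum_prod_eq_pow_shift (τ := freeTypes k) (fun t => typeCode t.1)
    (stateWeight (starTests k r) (deadStates k r) r κ) m 1
  rw [Finset.sum_coe_sort (freeTypes k) fun t => shift (typeCode t), sum_shift_freeTypes hts] at h
  rw [wordSum, ← h]
  refine Finset.sum_eq_zero fun c _ => ?_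
  rw [one_mul, stateWeight_prod_typeCode (fun j => (c j).1) hk hκ, if_neg]
  intro hr
  have h1 : m ≤ ∑ j : Fin m, (Finset.univ.filter fun i => (c j).1 i = none).card := by
    calc m = ∑ _j : Fin m, 1 := by simp
      _ ≤ _ := Finset.sum_le_sum fun j _ => by
        obtain ⟨i, hi⟩ := (Finset.mem_filter.1 (c j).2).2
        exact Finset.card_pos.2 ⟨i, by simpa using hi⟩
  have h2 : ∑ j : Fin m, (Finset.univ.filter fun i => (c j).1 i = none).card =
      ∑ i : Fin k, (Finset.univ.filter fun j => (c j).1 i = none).card := by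
    simp only [Finset.card_filter]
    exact Finset.sum_comm
  rw [h2, Finset.sum_congr rfl fun i _ => hr i] at h1
  simp at h1
  omega

theorem sum_weight_eq (hk : k ≤ 4) (hκ : IsConnectedWeight k κ) (hts : IsTypeList k r ts) (n : ℕ) :
    ((∑ c : Fin n → Fin k → Option Bool,
      if ∀ i, (Finset.univ.filter fun j => c j i = none).card = r then
        κ fun M => ∏ j, localCount (c j) M else 0 : ℤ) : ℝ) =
    2 ^ n * ∑ m ∈ Finset.range (k * r + 1), (n.choose m : ℝ) * (wordSum k r κ ts m / 2 ^ m) := by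
  obtain ⟨us, hus, hsum⟩ := sum_shift_typeCode hts
  have h := sum_prod_eq_pow_shift (fun t : Fin k → Option Bool => typeCode t)
    (stateWeight (starTests k r) (deadStates k r) r κ) n 1
  rw [hsum, shiftSum_append_pow_apply stateWeight_eq_zero_of_dead _ _ hus,
    shiftSum_cons_pow_apply] at h
  simp only [one_mul, one_pow, stateWeight_prod_typeCode _ hk hκ] at h
  -- The binomial sum runs over the number of constant letters; reflecting it indexes by the number
  -- `m` of letters with a free entry.
  rw [h, ← Finset.sum_range_reflect]
  have h1 : ∀ m ∈ Finset.range (n + 1),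
      ((n.choose (n + 1 - 1 - m) : ℤ) * (2 : ℕ) ^ (n + 1 - 1 - m) * (shiftSum ts ^ (n - (n + 1 - 1 - m)))
        (stateWeight (starTests k r) (deadStates k r) r κ) 1 : ℤ) =
      (n.choose m : ℤ) * 2 ^ (n - m) * wordSum k r κ ts m := by
    intro m hm
    have hm : m ≤ n := Nat.lt_succ_iff.1 (Finset.mem_range.1 hm)
    rw [Nat.add_sub_cancel, Nat.choose_symm hm, Nat.sub_sub_self hm]
    rfl
  rw [Finset.sum_congr rfl h1]
  push_cast
  have h2 : ∀ m ∈ Finset.range (n + 1), (n.choose m : ℝ) * 2 ^ (n - m) * wordSum k r κ ts m =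
      2 ^ n * ((n.choose m : ℝ) * (wordSum k r κ ts m / 2 ^ m)) := by
    intro m hm
    have hm : m ≤ n := Nat.lt_succ_iff.1 (Finset.mem_range.1 hm)
    rw [pow_sub₀ _ two_ne_zero hm]
    ring
  rw [Finset.sum_congr rfl h2, ← Finset.mul_sum]
  congr 1
  -- The ranges `m ≤ n` and `m ≤ k * r` agree up to zero terms: the binomial coefficient vanishes
  -- beyond `n`, the word sum beyond `k * r`.
  rcases le_total (n + 1) (k * r + 1) with hle | hle
  · refine Finset.sum_subset (Finset.range_mono hle) fun m _ hm => ?_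
    rw [Nat.choose_eq_zero_of_lt (by simpa using hm)]
    simp
  · refine (Finset.sum_subset (Finset.range_mono hle) fun m _ hm => ?_).symm
    rw [wordSum_eq_zero hk hκ hts (by simpa using hm)]
    simp

theorem wordSum_eq_getD {C D : List ℕ} {gs : List (ℕ × List (ℕ × ℕ))} (hC : starTests k r = C)
    (hD : deadStates k r = D) (hgs : GroupsCoprime gs) (hg : ∀ g ∈ gs, g.1 ∈ C) {f m : ℕ}
    (hm : m ≤ f) :
    wordSum k r κ (gs.flatMap Prod.snd) m = (evalGroups D (stateWeight C D r κ) gs f 0 1 1).getD m 0 := by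
  subst hC hD
  exact getD_evalGroups stateWeight_eq_zero_of_dead gs
    (fun g h => stateWeight_eq_zero_of_test g.1 (hg g h)) hgs hm

end WordSums

/-! ### Evaluation of the word sums -/

theorem isConnectedWeight_cumulant₂ : IsConnectedWeight 2 cumulant₂ where
  congr z z' h := by
    simp only [cumulant₂, h 3 (by norm_num) (by norm_num)]
  split z A hA h := by
    have hA' : A = 1 := by
      have : ∀ A ∈ splitMasks 2, A = 1 := by decide
      exact this A hA
    subst hA'
    have h3 := h 3 (by norm_num) (by decide)
    simp [cumulant₂, h3, Int.subNatNat_eq_coe]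

theorem isConnectedWeight_cumulant₃ : IsConnectedWeight 3 cumulant₃ where
  congr z z' h := by
    simp only [cumulant₃, h 3 (by norm_num) (by norm_num), h 5 (by norm_num) (by norm_num),
      h 6 (by norm_num) (by norm_num), h 7 (by norm_num) (by norm_num)]
  split z A hA h := by
    have hA' : A = 1 ∨ A = 3 ∨ A = 5 := by
      have : ∀ A ∈ splitMasks 3, A = 1 ∨ A = 3 ∨ A = 5 := by decide
      exact this A hA
    -- The full mask meets both parts of every splitting.
    have h7 : z 7 = 0 := h 7 (by norm_num) (by rcases hA' with rfl | rfl | rfl <;> decide)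
    simp only [cumulant₃, force_eq, Int.subNatNat_eq_coe, h7]
    rcases hA' with rfl | rfl | rfl
    · rw [h 3 (by norm_num) (by decide), h 5 (by norm_num) (by decide)]
      simp only [add_zero, zero_add, Nat.sub_zero]
      push_cast; ring
    · rw [h 5 (by norm_num) (by decide), h 6 (by norm_num) (by decide)]
      simp only [add_zero, Nat.sub_zero]
      push_cast; ring
    · rw [h 3 (by norm_num) (by decide), h 6 (by norm_num) (by decide)]
      simp only [add_zero, zero_add, Nat.sub_zero]
      push_cast; ring

/-- The seven cases are the splittings of four indices. Setting the crossing overlaps to zero makes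
the terms cancel, as expected for a joint cumulant of two independent groups. -/
theorem isConnectedWeight_cumulant₄ : IsConnectedWeight 4 cumulant₄ where
  congr z z' h := by
    simp only [cumulant₄, h 3 (by norm_num) (by norm_num), h 5 (by norm_num) (by norm_num),
      h 6 (by norm_num) (by norm_num), h 7 (by norm_num) (by norm_num),
      h 9 (by norm_num) (by norm_num), h 10 (by norm_num) (by norm_num),
      h 11 (by norm_num) (by norm_num), h 12 (by norm_num) (by norm_num),
      h 13 (by norm_num) (by norm_num), h 14 (by norm_num) (by norm_num),
      h 15 (by norm_num) (by norm_num)]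
  split z A hA h := by
    have hA' : A = 1 ∨ A = 3 ∨ A = 5 ∨ A = 7 ∨ A = 9 ∨ A = 11 ∨ A = 13 := by
      have : ∀ A ∈ splitMasks 4,
        A = 1 ∨ A = 3 ∨ A = 5 ∨ A = 7 ∨ A = 9 ∨ A = 11 ∨ A = 13 := by decide
      exact this A hA
    have h15 : z 15 = 0 := h 15 (by norm_num)
      (by rcases hA' with rfl | rfl | rfl | rfl | rfl | rfl | rfl <;> decide)
    simp only [cumulant₄, force_eq, Int.subNatNat_eq_coe, h15]
    rcases hA' with rfl | rfl | rfl | rfl | rfl | rfl | rfl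
    · rw [h 3 (by norm_num) (by decide), h 5 (by norm_num) (by decide),
        h 7 (by norm_num) (by decide), h 9 (by norm_num) (by decide),
        h 11 (by norm_num) (by decide), h 13 (by norm_num) (by decide)]
      simp only [add_zero, zero_add, Nat.sub_zero]
      push_cast; ring
    · rw [h 5 (by norm_num) (by decide), h 6 (by norm_num) (by decide),
        h 7 (by norm_num) (by decide), h 9 (by norm_num) (by decide),
        h 10 (by norm_num) (by decide), h 11 (by norm_num) (by decide),
        h 13 (by norm_num) (by decide), h 14 (by norm_num) (by decide)]
      simp only [add_zero, zero_add, Nat.sub_zero]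
      push_cast; ring
    · rw [h 3 (by norm_num) (by decide), h 6 (by norm_num) (by decide),
        h 7 (by norm_num) (by decide), h 9 (by norm_num) (by decide),
        h 11 (by norm_num) (by decide), h 12 (by norm_num) (by decide),
        h 13 (by norm_num) (by decide), h 14 (by norm_num) (by decide)]
      simp only [add_zero, zero_add, Nat.sub_zero]
      push_cast; ring
    · rw [h 9 (by norm_num) (by decide), h 10 (by norm_num) (by decide),
        h 11 (by norm_num) (by decide), h 12 (by norm_num) (by decide),
        h 13 (by norm_num) (by decide), h 14 (by norm_num) (by decide)]
      simp only [add_zero, Nat.sub_zero]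
      push_cast; ring
    · rw [h 3 (by norm_num) (by decide), h 5 (by norm_num) (by decide),
        h 7 (by norm_num) (by decide), h 10 (by norm_num) (by decide),
        h 11 (by norm_num) (by decide), h 12 (by norm_num) (by decide),
        h 13 (by norm_num) (by decide), h 14 (by norm_num) (by decide)]
      simp only [add_zero, zero_add, Nat.sub_zero]
      push_cast; ring
    · rw [h 5 (by norm_num) (by decide), h 6 (by norm_num) (by decide),
        h 7 (by norm_num) (by decide), h 12 (by norm_num) (by decide),
        h 13 (by norm_num) (by decide), h 14 (by norm_num) (by decide)]
      simp only [add_zero, zero_add, Nat.sub_zero]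
      push_cast; ring
    · rw [h 3 (by norm_num) (by decide), h 6 (by norm_num) (by decide),
        h 7 (by norm_num) (by decide), h 10 (by norm_num) (by decide),
        h 11 (by norm_num) (by decide), h 14 (by norm_num) (by decide)]
      simp only [add_zero, zero_add, Nat.sub_zero]
      push_cast; ring

/-- The codes of the coordinate types of two subcubes with a free coordinate, grouped by the first
subcube that is free, each group with its test for dimension two. -/
def codeGroups_2_2 : List (ℕ × List (ℕ × ℕ)) :=
  [(9, [(1, 105), (2, 3)]), (25, [(2, 5)])]

/-- The listed weights are 2 because exchanging the two coordinate values preserves the code; only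
the letter that is free everywhere is fixed by this exchange. -/
theorem isTypeList_2_2 : IsTypeList 2 2 (codeGroups_2_2.flatMap Prod.snd) where
  free := by decide +kernel
  fixed := by decide +kernel
  dead := by decide +kernel

theorem evalGroups_2_2 :
    evalGroups [27, 125, 71]
      (stateWeight [9, 25]
        [27, 125, 71] 2 cumulant₂)
      codeGroups_2_2 4 0 1 1 =
    [0, 0, 15, 72, 96] := by
  decide +kernel

theorem wordSum_2_2 {m : ℕ} (hm : m ≤ 4) :
    wordSum 2 2 cumulant₂ (codeGroups_2_2.flatMap Prod.snd) m =
      ([0, 0, 15, 72, 96] : List ℤ).getD m 0 := by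
  exact (wordSum_eq_getD (by decide +kernel) (by decide +kernel)
    (by unfold GroupsCoprime; decide +kernel) (by decide +kernel) hm).trans
    (congrArg (fun l => l.getD m 0) evalGroups_2_2)

/-- The codes of the coordinate types of three subcubes with a free coordinate, grouped by the first
subcube that is free, each group with its test for dimension two. -/
def codeGroups_3_2 : List (ℕ × List (ℕ × ℕ)) :=
  [(9, [(1, 4849845), (2, 429), (2, 105), (2, 3), (2, 22161)]), (25, [(2, 935), (2, 5), (2,
  35155)]), (121, [(2, 11), (2, 69509)])]

theorem isTypeList_3_2 : IsTypeList 3 2 (codeGroups_3_2.flatMap Prod.snd) where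
  free := by decide +kernel
  fixed := by decide +kernel
  dead := by decide +kernel

theorem evalGroups_3_2 :
    evalGroups [27, 125, 1331, 499201, 583573, 524477]
      (stateWeight [9, 25, 121]
        [27, 125, 1331, 499201, 583573, 524477] 2 cumulant₃)
      codeGroups_3_2 6 0 1 1 =
    [0, 0, 210, 4728, 27360, 63360, 51840] := by
  decide +kernel

theorem wordSum_3_2 {m : ℕ} (hm : m ≤ 6) :
    wordSum 3 2 cumulant₃ (codeGroups_3_2.flatMap Prod.snd) m =
      ([0, 0, 210, 4728, 27360, 63360, 51840] : List ℤ).getD m 0 := by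
  exact (wordSum_eq_getD (by decide +kernel) (by decide +kernel)
    (by unfold GroupsCoprime; decide +kernel) (by decide +kernel) hm).trans
    (congrArg (fun l => l.getD m 0) evalGroups_3_2)

/-- The codes of the coordinate types of three subcubes with a free coordinate, grouped by the first
subcube that is free, each group with its test for dimension three. -/
def codeGroups_3_3 : List (ℕ × List (ℕ × ℕ)) :=
  [(27, [(1, 4849845), (2, 429), (2, 105), (2, 3), (2, 22161)]), (125, [(2, 935), (2, 5), (2,
  35155)]), (1331, [(2, 11), (2, 69509)])]

theorem isTypeList_3_3 : IsTypeList 3 3 (codeGroups_3_3.flatMap Prod.snd) where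
  free := by decide +kernel
  fixed := by decide +kernel
  dead := by decide +kernel

theorem evalGroups_3_3 :
    evalGroups [81, 625, 14641, 499201, 583573, 524477]
      (stateWeight [27, 125, 1331]
        [81, 625, 14641, 499201, 583573, 524477] 3 cumulant₃)
      codeGroups_3_3 9 0 1 1 =
    [0, 0, 0, 64770, 768816, 4020480, 13455360, 28667520, 34836480, 18063360] := by
  decide +kernel

theorem wordSum_3_3 {m : ℕ} (hm : m ≤ 9) :
    wordSum 3 3 cumulant₃ (codeGroups_3_3.flatMap Prod.snd) m =
      ([0, 0, 0, 64770, 768816, 4020480, 13455360, 28667520, 34836480, 18063360] : List ℤ).getD m 0 := by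
  exact (wordSum_eq_getD (by decide +kernel) (by decide +kernel)
    (by unfold GroupsCoprime; decide +kernel) (by decide +kernel) hm).trans
    (congrArg (fun l => l.getD m 0) evalGroups_3_3)

/-- The codes of the coordinate types of four subcubes with a free coordinate, grouped by the first
subcube that is free, each group with its test for dimension two. -/
def codeGroups_4_2 : List (ℕ × List (ℕ × ℕ)) :=
  [(9, [(1, 16294579238595022365), (2, 504470109), (2, 80330145), (2, 4849845), (2, 2001), (2,
  245917935519), (2, 429), (2, 78659885733), (2, 105), (2, 21516382545), (2, 3), (2,
  6775201486527), (2, 4541186224569), (2, 4063360670697)]), (25, [(2, 1284644185), (2, 3565),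
  (2, 371044818545), (2, 935), (2, 149577579635), (2, 5), (2, 11072740293515), (2,
  7203889793995), (2, 5623957018255)]), (121, [(2, 10373), (2, 918772116779), (2, 11), (2,
  23019109637711), (2, 12744918408893), (2, 11119773243689)]), (529, [(2, 23), (2,
  25233441498599), (2, 21474006392389), (2, 18185983783783)])]

theorem isTypeList_4_2 : IsTypeList 4 2 (codeGroups_4_2.flatMap Prod.snd) where
  free := by decide +kernel
  fixed := by decide +kernel
  dead := by decide +kernel

/-- The first four dead states are the cubes of 3, 5, 11, 23, the marks of the single subcubes; the
other seven are the products of conflict marks for the seven splittings. -/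
theorem evalGroups_4_2 :
    evalGroups [27, 125, 1331, 12167, 79860189659221,
        1221211897146174673, 1161479522184373331, 228098450046409, 1127395785758588309,
        119584570580317, 96166202539829]
      (stateWeight [9, 25, 121, 529]
        [27, 125, 1331, 12167, 79860189659221,
        1221211897146174673, 1161479522184373331, 228098450046409, 1127395785758588309,
        119584570580317, 96166202539829] 2 cumulant₄)
      codeGroups_4_2 8 0 1 1 =
    [0, 0, 2490, 283896, 4517088, 29230080, 92298240, 141281280, 83865600] := by
  decide +kernel

theorem wordSum_4_2 {m : ℕ} (hm : m ≤ 8) :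
    wordSum 4 2 cumulant₄ (codeGroups_4_2.flatMap Prod.snd) m =
      ([0, 0, 2490, 283896, 4517088, 29230080, 92298240, 141281280, 83865600] : List ℤ).getD m 0 := by
  exact (wordSum_eq_getD (by decide +kernel) (by decide +kernel)
    (by unfold GroupsCoprime; decide +kernel) (by decide +kernel) hm).trans
    (congrArg (fun l => l.getD m 0) evalGroups_4_2)

/-! ### Subcubes and their codes -/

/-- The subcube with a given code: a coordinate is free (`none`) or has a prescribed value. -/
def codeCube {n : ℕ} (C : Fin n → Option Bool) : Finset (Cube n) :=
  Finset.univ.filter fun x => ∀ j, C j = none ∨ C j = some (x j)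

/-- The codes of the `r`-dimensional subcubes. -/
abbrev CubeCode (n r : ℕ) : Type :=
  {C : Fin n → Option Bool // (Finset.univ.filter fun j => C j = none).card = r}

/-- An intersection of subcubes is a product of subsets of `Bool`, one for each coordinate. -/
theorem overlapCard_codeCube {n k : ℕ} (c : Fin k → Fin n → Option Bool) (M : ℕ) :
    overlapCard (fun i => codeCube (c i)) M = ∏ j, localCount (fun i => c i j) M := by
  unfold overlapCard localCount
  rw [← Fintype.card_piFinset]
  congr 1
  ext x
  simp only [codeCube, Finset.mem_filter, Finset.mem_univ, true_and, Fintype.mem_piFinset]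
  exact ⟨fun h j i hi => h i hi j, fun h i hi j => h j i hi⟩

theorem card_codeCube {n r : ℕ} (C : CubeCode n r) : (codeCube C.1).card = 2 ^ r := by
  have h : codeCube C.1 = Fintype.piFinset fun j =>
      Finset.univ.filter fun b : Bool => C.1 j = none ∨ C.1 j = some b := by
    ext x; simp [codeCube]
  have h2 : ∀ j, (Finset.univ.filter fun b : Bool => C.1 j = none ∨ C.1 j = some b).card =
      if C.1 j = none then 2 else 1 := by
    intro j
    rcases C.1 j with _ | b
    · rfl
    · cases b <;> rfl
  rw [h, Fintype.card_piFinset, Finset.prod_congr rfl fun j _ => h2 j, ← Finset.prod_filter,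
    Finset.prod_const, C.2]

theorem codeCube_injective {n : ℕ} : Function.Injective (codeCube (n := n)) := by
  intro C C' h
  have hsub : ∀ C C' : Fin n → Option Bool, codeCube C ⊆ codeCube C' →
      ∀ j, C' j = none ∨ C j = C' j := by
    intro C C' h j
    by_cases hj : C' j = none
    · exact Or.inl hj
    · right
      -- If coordinate `j` is free in `C`, these points of `codeCube C` take both values there,
      -- which a prescribed value of `C'` at `j` cannot allow.
      have hx : ∀ v : Bool, (Function.update (fun j => (C j).getD false) j ((C j).getD v)) ∈
          codeCube C := by
        intro v
        simp only [codeCube, Finset.mem_filter, Finset.mem_univ, true_and]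
        intro i
        by_cases hi : i = j
        · subst hi
          rcases C i <;> simp
        · rw [Function.update_of_ne hi]
          rcases C i <;> simp
      have hy : ∀ v : Bool, C' j = some ((C j).getD v) := fun v => by
        have := (Finset.mem_filter.1 (h (hx v))).2 j
        rw [Function.update_self] at this
        exact this.resolve_left hj
      have h1 := hy true
      have h2 := hy false
      rcases hC : C j with _ | b
      · simp [hC] at h1 h2
        simp [h1] at h2
      · rw [h1, hC]; rfl
  funext j
  rcases hsub C C' h.subset j with h1 | h1
  · rcases hsub C' C h.superset j with h2 | h2
    · rw [h1, h2]
    · exact h2.symm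
  · exact h1

theorem subcubes_eq_image (n r : ℕ) :
    subcubes n r = Finset.univ.image fun C : CubeCode n r => codeCube C.1 := by
  ext Q
  simp only [subcubes, Finset.mem_filter, Finset.mem_univ, true_and, Finset.mem_image]
  constructor
  · rintro ⟨J, a, hJ, rfl⟩
    refine ⟨⟨fun j => if j ∈ J then none else some (a j), ?_⟩, ?_⟩
    · simpa using hJ
    · ext x
      simp only [codeCube, subcube, Finset.mem_filter, Finset.mem_univ, true_and]
      refine forall_congr' fun j => ?_
      by_cases hj : j ∈ J <;> simp [hj, eq_comm]
  · rintro ⟨⟨C, hC⟩, rfl⟩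
    refine ⟨Finset.univ.filter fun j => C j = none, fun j => (C j).getD false, hC, ?_⟩
    ext x
    simp only [codeCube, subcube, Finset.mem_filter, Finset.mem_univ, true_and]
    refine forall_congr' fun j => ?_
    rcases C j with _ | b
    · simp
    · simp [eq_comm (a := b)]

theorem subcubeCount_eq (n r : ℕ) (S : Finset (Cube n)) :
    (subcubeCount n r S : ℝ) = ∑ C : CubeCode n r, if codeCube C.1 ⊆ S then 1 else 0 := by
  rw [subcubeCount, subcubes_eq_image, Finset.card_filter, Finset.sum_image]
  · push_cast; rfl
  · exact fun C _ C' _ h => Subtype.ext (codeCube_injective h)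

theorem subcubeCentralMoment_eq (n r k : ℕ) :
    subcubeCentralMoment n r k = (1 / 2 ^ 2 ^ r) ^ k *
      ∑ c : Fin k → CubeCode n r, avg fun S => ∏ i, (scaledInd (codeCube (c i).1) S - 1) := by
  rw [subcubeCentralMoment, uniformSubset, centralMoment_uniformOn_univ]
  exact avg_centered_pow (fun C : CubeCode n r => codeCube C.1) _ card_codeCube _
    (subcubeCount_eq n r) k

/-- The sum of `κ` over all families of `k` subcubes of dimension `r`. -/
noncomputable def cubeSum (n r k : ℕ) (κ : (ℕ → ℕ) → ℤ) : ℝ :=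
  ∑ c : Fin k → CubeCode n r, (κ (overlapCard fun i => codeCube (c i).1) : ℝ)

/-- Transposition of the `k × n` array of entries turns tuples of subcubes into words of coordinate
types. -/
theorem cubeSum_eq {k r : ℕ} {κ : (ℕ → ℕ) → ℤ} {ts : List (ℕ × ℕ)} (hk : k ≤ 4)
    (hκ : IsConnectedWeight k κ) (hts : IsTypeList k r ts) (n : ℕ) :
    cubeSum n r k κ =
      2 ^ n * ∑ m ∈ Finset.range (k * r + 1), (n.choose m : ℝ) * (wordSum k r κ ts m / 2 ^ m) := by
  rw [← sum_weight_eq hk hκ hts n, ← Finset.sum_filter, cubeSum]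
  push_cast
  refine Finset.sum_bij (fun c _ j i => (c i).1 j) ?_ ?_ ?_ ?_
  · exact fun c _ => Finset.mem_filter.2 ⟨Finset.mem_univ _, fun i => (c i).2⟩
  · exact fun c _ c' _ h => funext fun i => Subtype.ext (funext fun j => congrFun (congrFun h j) i)
  · intro d hd
    exact ⟨fun i => ⟨fun j => d j i, (Finset.mem_filter.1 hd).2 i⟩, Finset.mem_univ _, rfl⟩
  · intro c _
    rw [show overlapCard (fun i => codeCube (c i).1) = fun M => ∏ j, localCount (fun i => (c i).1 j) M
      from funext fun M => overlapCard_codeCube (fun i => (c i).1) M]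

theorem subcubeCentralMoment_three (n r : ℕ) :
    subcubeCentralMoment n r 3 = (1 / 2 ^ 2 ^ r) ^ 3 * cubeSum n r 3 cumulant₃ := by
  rw [subcubeCentralMoment_eq, cubeSum]
  simp only [cumulant₃_overlapCard fun i => codeCube _]

theorem sum_fin_two {ι : Type*} [Fintype ι] (f : (Fin 2 → ι) → ℝ) :
    ∑ c, f c = ∑ a, ∑ b, f ![a, b] := by
  rw [← (finTwoArrowEquiv ι).symm.sum_comp, Fintype.sum_prod_type]
  rfl

theorem sum_fin_four {ι : Type*} [Fintype ι] (f : (Fin 4 → ι) → ℝ) :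
    ∑ c, f c = ∑ a, ∑ b, ∑ d, ∑ e, f ![a, b, d, e] := by
  rw [← (Fin.consEquiv fun _ => ι).sum_comp, Fintype.sum_prod_type]
  refine Finset.sum_congr rfl fun a _ => ?_
  rw [← (Fin.consEquiv fun _ => ι).sum_comp, Fintype.sum_prod_type]
  refine Finset.sum_congr rfl fun b _ => ?_
  rw [sum_fin_two]
  rfl

theorem subcubeCentralMoment_four (n r : ℕ) :
    subcubeCentralMoment n r 4 = (1 / 2 ^ 2 ^ r) ^ 4 *
      (cubeSum n r 4 cumulant₄ + 3 * cubeSum n r 2 cumulant₂ ^ 2) := by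
  set g : CubeCode n r → CubeCode n r → ℝ := fun a b =>
    (cumulant₂ (overlapCard ![codeCube a.1, codeCube b.1]) : ℝ) with hg
  have h2 : cubeSum n r 2 cumulant₂ = ∑ a, ∑ b, g a b := by
    rw [cubeSum, sum_fin_two]
    refine Finset.sum_congr rfl fun a _ => Finset.sum_congr rfl fun b _ => ?_
    rw [hg]
    congr 3
    funext i
    fin_cases i <;> rfl
  have hsq : (∑ a, ∑ b, g a b) ^ 2 = ∑ a, ∑ b, ∑ d, ∑ e, g a b * g d e := by
    simp only [pow_two, Finset.sum_mul]
    simp only [Finset.mul_sum]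
  -- The other two pairings reduce to the first by reordering the summations.
  have h13 : ∑ a, ∑ b, ∑ d, ∑ e, g a d * g b e = ∑ a, ∑ b, ∑ d, ∑ e, g a b * g d e :=
    Finset.sum_congr rfl fun a _ => Finset.sum_comm
  have h14 : ∑ a, ∑ b, ∑ d, ∑ e, g a e * g b d = ∑ a, ∑ b, ∑ d, ∑ e, g a b * g d e :=
    Finset.sum_congr rfl fun a _ =>
      (Finset.sum_congr rfl fun b _ => Finset.sum_comm).trans Finset.sum_comm
  rw [subcubeCentralMoment_eq, Finset.sum_congr rfl fun c _ =>
    cumulant₄_overlapCard fun i => codeCube (c i).1]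
  simp only [Finset.sum_add_distrib]
  rw [h2, hsq, cubeSum, sum_fin_four (fun c : Fin 4 → CubeCode n r =>
      (cumulant₂ (overlapCard ![codeCube (c 0).1, codeCube (c 1).1]) : ℝ) *
        cumulant₂ (overlapCard ![codeCube (c 2).1, codeCube (c 3).1])),
    sum_fin_four (fun c : Fin 4 → CubeCode n r =>
      (cumulant₂ (overlapCard ![codeCube (c 0).1, codeCube (c 2).1]) : ℝ) *
        cumulant₂ (overlapCard ![codeCube (c 1).1, codeCube (c 3).1])),
    sum_fin_four (fun c : Fin 4 → CubeCode n r =>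
      (cumulant₂ (overlapCard ![codeCube (c 0).1, codeCube (c 3).1]) : ℝ) *
        cumulant₂ (overlapCard ![codeCube (c 1).1, codeCube (c 2).1]))]
  change _ * (_ + ∑ a, ∑ b, ∑ d, ∑ e, g a b * g d e + ∑ a, ∑ b, ∑ d, ∑ e, g a d * g b e +
    ∑ a, ∑ b, ∑ d, ∑ e, g a e * g b d) = _
  rw [h13, h14]
  ring

/-! ### Polynomial form of the cumulant sums -/

/-- Used repeatedly, this expands the binomial coefficients into polynomials in `n` that are valid
for every `n`, including `n < m`, where both sides vanish. -/
theorem cast_choose_succ (n m : ℕ) :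
    (n.choose (m + 1) : ℝ) = n.choose m * ((n : ℝ) - m) / (m + 1) := by
  rw [eq_div_iff (by positivity)]
  rcases le_or_gt m n with h | h
  · rw [← Nat.cast_sub h]
    exact_mod_cast Nat.choose_succ_right_eq n m
  · rw [Nat.choose_eq_zero_of_lt h, Nat.choose_eq_zero_of_lt (by omega)]
    simp

theorem cubeSum_two_two (n : ℕ) : cubeSum n 2 2 cumulant₂ =
    2 ^ n * ((n : ℝ) * (n - 1) * (2 * n ^ 2 + 2 * n + 3) / 8) := by
  rw [cubeSum_eq (by norm_num) isConnectedWeight_cumulant₂ isTypeList_2_2]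
  simp only [Nat.reduceMul, Nat.reduceAdd, Finset.sum_range_succ, Finset.sum_range_zero]
  rw [wordSum_2_2 (m := 0) (by norm_num), wordSum_2_2 (m := 1) (by norm_num), wordSum_2_2 (m := 2)
    (by norm_num), wordSum_2_2 (m := 3) (by norm_num), wordSum_2_2 (m := 4) (by norm_num)]
  simp only [cast_choose_succ, Nat.choose_zero_right, List.getD_cons_zero, List.getD_cons_succ]
  push_cast
  ring

theorem cubeSum_two_three (n : ℕ) : cubeSum n 2 3 cumulant₃ =
    2 ^ n * ((n : ℝ) * (n - 1) / 8 *
      (9 * n ^ 4 + 6 * n ^ 3 + 21 * n ^ 2 - 16 * n - 34)) := by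
  rw [cubeSum_eq (by norm_num) isConnectedWeight_cumulant₃ isTypeList_3_2]
  simp only [Nat.reduceMul, Nat.reduceAdd, Finset.sum_range_succ, Finset.sum_range_zero]
  rw [wordSum_3_2 (m := 0) (by norm_num), wordSum_3_2 (m := 1) (by norm_num), wordSum_3_2 (m := 2)
    (by norm_num), wordSum_3_2 (m := 3) (by norm_num), wordSum_3_2 (m := 4) (by norm_num),
    wordSum_3_2 (m := 5) (by norm_num), wordSum_3_2 (m := 6) (by norm_num)]
  simp only [cast_choose_succ, Nat.choose_zero_right, List.getD_cons_zero, List.getD_cons_succ]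
  push_cast
  ring

theorem cubeSum_three_three (n : ℕ) : cubeSum n 3 3 cumulant₃ =
    2 ^ n * ((n : ℝ) * (n - 1) * (n - 2) / 144 * (14 * n ^ 6 + 24 * n ^ 5 + 479 * n ^ 4
      + 2046 * n ^ 3 + 6779 * n ^ 2 + 15444 * n - 23112)) := by
  rw [cubeSum_eq (by norm_num) isConnectedWeight_cumulant₃ isTypeList_3_3]
  simp only [Nat.reduceMul, Nat.reduceAdd, Finset.sum_range_succ, Finset.sum_range_zero]
  rw [wordSum_3_3 (m := 0) (by norm_num), wordSum_3_3 (m := 1) (by norm_num), wordSum_3_3 (m := 2)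
    (by norm_num), wordSum_3_3 (m := 3) (by norm_num), wordSum_3_3 (m := 4) (by norm_num),
    wordSum_3_3 (m := 5) (by norm_num), wordSum_3_3 (m := 6) (by norm_num), wordSum_3_3 (m := 7)
    (by norm_num), wordSum_3_3 (m := 8) (by norm_num), wordSum_3_3 (m := 9) (by norm_num)]
  simp only [cast_choose_succ, Nat.choose_zero_right, List.getD_cons_zero, List.getD_cons_succ]
  push_cast
  ring

theorem cubeSum_two_four (n : ℕ) : cubeSum n 2 4 cumulant₄ =
    2 ^ n * ((n : ℝ) * (n - 1) / 64 * (520 * n ^ 6 - 24 * n ^ 5 + 1272 * n ^ 4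
      - 840 * n ^ 3 - 5232 * n ^ 2 - 2768 * n + 240)) := by
  rw [cubeSum_eq (by norm_num) isConnectedWeight_cumulant₄ isTypeList_4_2]
  simp only [Nat.reduceMul, Nat.reduceAdd, Finset.sum_range_succ, Finset.sum_range_zero]
  rw [wordSum_4_2 (m := 0) (by norm_num), wordSum_4_2 (m := 1) (by norm_num), wordSum_4_2 (m := 2)
    (by norm_num), wordSum_4_2 (m := 3) (by norm_num), wordSum_4_2 (m := 4) (by norm_num),
    wordSum_4_2 (m := 5) (by norm_num), wordSum_4_2 (m := 6) (by norm_num), wordSum_4_2 (m := 7)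
    (by norm_num), wordSum_4_2 (m := 8) (by norm_num)]
  simp only [cast_choose_succ, Nat.choose_zero_right, List.getD_cons_zero, List.getD_cons_succ]
  push_cast
  ring

theorem mainTheorem4 (n : ℕ) :
    subcubeCentralMoment n 2 3 =
      (2 : ℝ) ^ n * (n : ℝ) * ((n : ℝ) - 1) / 32768 *
        (9 * (n : ℝ) ^ 4 + 6 * (n : ℝ) ^ 3 + 21 * (n : ℝ) ^ 2 - 16 * (n : ℝ) - 34) ∧
    subcubeCentralMoment n 2 4 =
      (2 : ℝ) ^ n * (n : ℝ) * ((n : ℝ) - 1) / 4194304 *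
        (12 * (n : ℝ) ^ 6 * (2 : ℝ) ^ n + 12 * (n : ℝ) ^ 5 * (2 : ℝ) ^ n + 520 * (n : ℝ) ^ 6
          + 24 * (n : ℝ) ^ 4 * (2 : ℝ) ^ n - 24 * (n : ℝ) ^ 5 - 12 * (n : ℝ) ^ 3 * (2 : ℝ) ^ n
          + 1272 * (n : ℝ) ^ 4 - 9 * (n : ℝ) ^ 2 * (2 : ℝ) ^ n - 840 * (n : ℝ) ^ 3
          - 27 * (n : ℝ) * (2 : ℝ) ^ n - 5232 * (n : ℝ) ^ 2 - 2768 * (n : ℝ) + 240) ∧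
    subcubeCentralMoment n 3 3 =
      (2 : ℝ) ^ n * (n : ℝ) * ((n : ℝ) - 1) * ((n : ℝ) - 2) / 2415919104 *
        (14 * (n : ℝ) ^ 6 + 24 * (n : ℝ) ^ 5 + 479 * (n : ℝ) ^ 4 + 2046 * (n : ℝ) ^ 3
          + 6779 * (n : ℝ) ^ 2 + 15444 * (n : ℝ) - 23112) := by
  refine ⟨?_, ?_, ?_⟩
  · rw [subcubeCentralMoment_three, cubeSum_two_three]
    ring
  · rw [subcubeCentralMoment_four, cubeSum_two_four, cubeSum_two_two]
    ring
  · rw [subcubeCentralMoment_three, cubeSum_three_three]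
    ring
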